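/- For a positive integer $n$ and a real $d>0$, let $G(\mathbb{Q}^n,d)$ be the graph with vertex set $\mathbb{Q}^n$ in which two points are adjacent if and only if their Euclidean distance is $d$, and let $\omega(\mathbb{Q}^n,d)$ be its clique number, that is, the largest number of points of $\mathbb{Q}^n$ that are pairwise at distance $d$. Put $$C_1(\mathbb{Q}^n)=\max\{\omega(\mathbb{Q}^n,d): d>0\},\qquad c_1(\mathbb{Q}^n)=\min\{\omega(\mathbb{Q}^n,d): d>0 \text{ is the distance between some two points of } \mathbb{Q}^n\}.$$ (a) For every positive integer $n$ these maxima and this minimum exist, and $C_1(\mathbb{Q}^n)-c_1(\mathbb{Q}^n)\le 3$. (b) Let $m$ be a positive integer, let $r$ be a positive rational number, and let $P_1,\dots,P_{4m}\in\mathbb{Q}^{4m}$ be pairwise at distance $\sqrt r$. Let $P_i'\in\mathbb{Q}^{4m+3}$ be obtained from $P_i$ by appending three zero coordinates. Then there is a point $P\in\mathbb{Q}^{4m+3}$ at distance $\sqrt r$ from each of $P_1',\dots,P_{4m}'$. (c) For all positive integers $r$ and $m$, the equation $$\frac{r(4m-1)}{8m}+2rmx^2+y^2+z^2+w^2=r$$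 has a solution in rational numbers $x,y,z,w$. -/

import Mathlib

/-- The points of `ℝⁿ` (with the Euclidean metric) all of whose coordinates lie in `S`. -/
abbrev PointsIn (S : Set ℝ) (n : ℕ) : Type :=
  {x : EuclideanSpace ℝ (Fin n) // ∀ i, x i ∈ S}

/-- The distance graph `G(Sⁿ, d)`: two distinct points of `Sⁿ` are adjacent if and only if they
are at Euclidean distance `d`. (For `d > 0` distinctness is automatic.) -/
def distanceGraph (S : Set ℝ) (n : ℕ) (d : ℝ) : SimpleGraph (PointsIn S n) where
  Adj x y := x ≠ y ∧ dist x y = d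
  symm := ⟨fun x y h => ⟨h.1.symm, (dist_comm y x).trans h.2⟩⟩
  loopless := ⟨fun _ h => h.1 rfl⟩

/-- `d` is realized as a distance between points of `Sⁿ`. -/
def IsRealized (S : Set ℝ) (n : ℕ) (d : ℝ) : Prop :=
  ∃ x y : PointsIn S n, dist x y = d

/-- The values `ω(Sⁿ, d)` over all `d > 0`. -/
def cliqueValues (S : Set ℝ) (n : ℕ) : Set ℕ :=
  {k | ∃ d : ℝ, 0 < d ∧ (distanceGraph S n d).cliqueNum = k}

/-- The values `ω(Sⁿ, d)` over all realized `d > 0`. -/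
def realizedCliqueValues (S : Set ℝ) (n : ℕ) : Set ℕ :=
  {k | ∃ d : ℝ, 0 < d ∧ IsRealized S n d ∧ (distanceGraph S n d).cliqueNum = k}

/-- The clique number `C₁(Sⁿ)` (a maximum whenever `cliqueValues S n` is bounded). -/
noncomputable def upperCliqueNumber (S : Set ℝ) (n : ℕ) : ℕ :=
  sSup (cliqueValues S n)

/-- The lower clique number `c₁(Sⁿ)` (a minimum whenever some `d > 0` is realized). -/
noncomputable def lowerCliqueNumber (S : Set ℝ) (n : ℕ) : ℕ :=
  sInf (realizedCliqueValues S n)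

/-- The set `ℚ` of rational numbers inside `ℝ`. -/
def rationals : Set ℝ := Set.range ((↑) : ℚ → ℝ)

/-- The rational point of `ℝⁿ⁺ᵏ` obtained from a rational point of `ℝⁿ` by placing zeroes as its
last `k` coordinates. -/
def padZeros {n : ℕ} (k : ℕ) (x : PointsIn rationals n) : PointsIn rationals (n + k) :=
  ⟨WithLp.toLp 2 (Fin.append (fun i => x.1 i) (fun _ : Fin k => (0 : ℝ))), fun i => by
    refine Fin.addCases (fun j => ?_) (fun j => ?_) i
    · simpa using x.2 j
    · rw [PiLp.toLp_apply, Fin.append_right]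
      exact ⟨0, Rat.cast_zero⟩⟩

/-!
For `n = 4 m + j` with `j ≤ 3`, every rational squared distance `r` admits a clique of `4 m` points
in `ℚⁿ`: half of `r` is a sum of four squares, so multiplication by a quaternion turns the standard
orthonormal basis of `ℚ⁴ᵐ` into orthogonal vectors of squared length `r / 2`, which are pairwise at
distance `√r` (`exists_equidistant_four_mul`). As no clique has more than `n + 1` points
(`card_le_of_isNClique`), the two clique numbers differ by at most three, except that for `j = 3`
one further point is needed; for `n < 4` a pair of points is enough.

That point lies above the centre of the simplex. If `q i` are the centred vertices and `v` is a
rational normal vector, the square matrix with rows `q i + v` has Gram matrix a scalar plus a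
multiple of the all-ones matrix; its determinant shows that `2 r m |v|²` is a rational square
(`sq_det_add_normal`), so `v` can be rescaled to squared length `2 r m`. Moving by `x v` along the
normal and by `(y, z, w)` in the three new coordinates, the point has distance `√r` to all vertices
exactly when `(x, y, z, w)` solves the Diophantine equation.

With `x = u / (4 m)` the equation asks that `2 r m (4 m + 1 - u²)` be a sum of three rational
squares, and one of `u = 0, 1, 2` always avoids the numbers `4ᵃ (8 b + 7)`
(`exists_isSumThreeSq_two_mul`). The three-square theorem is proved in Dirichlet's way: primes in
arithmetic progressions and quadratic reciprocity provide a positive definite integral ternary form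
of determinant one with last coefficient `n`, and by Hermite reduction such a form is equivalent to
`x² + y² + z²` (`exists_three_squares_of_ternary_det_one`).
-/

open scoped NumberTheorySymbols

/-! ### Ternary quadratic forms of determinant one -/

theorem Int.exists_two_mul_abs_add_mul_le (b : ℤ) {a : ℤ} (ha : 0 < a) :
    ∃ k : ℤ, 2 * |b + k * a| ≤ a := by
  refine ⟨-((2 * b + a) / (2 * a)), ?_⟩
  have h1 := Int.emod_nonneg (2 * b + a) (show 2 * a ≠ 0 by omega)
  have h2 := Int.emod_lt_of_pos (2 * b + a) (show 0 < 2 * a by omega)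
  have h3 := Int.emod_add_mul_ediv (2 * b + a) (2 * a)
  rw [show b + -((2 * b + a) / (2 * a)) * a = b - a * ((2 * b + a) / (2 * a)) by ring]
  generalize (2 * b + a) / (2 * a) = q at *
  generalize (2 * b + a) % (2 * a) = t at *
  have : 2 * a * q = 2 * (a * q) := by ring
  rw [this] at h3
  generalize a * q = w at *
  have : |b - w| * 2 ≤ a := by
    rcases abs_cases (b - w) with ⟨h, _⟩ | ⟨h, _⟩ <;> rw [h] <;> omega
  omega

/-- An integral ternary form of determinant one with positive leading minors takes only values
which are sums of three integer squares. The induction runs over the first two leading minors `α`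
and `δ`, lexicographically. -/
theorem exists_three_squares_of_ternary_det_one (α : ℕ) : ∀ (δ : ℕ) (a b c d e f : ℤ),
    a = α → a * b - f ^ 2 = δ → 0 < a → 0 < a * b - f ^ 2 →
    a * b * c + 2 * d * e * f - a * d ^ 2 - b * e ^ 2 - c * f ^ 2 = 1 →
    ∀ x y z : ℤ, ∃ p q r : ℤ,
      a * x ^ 2 + b * y ^ 2 + c * z ^ 2 + 2 * d * y * z + 2 * e * x * z + 2 * f * x * y
        = p ^ 2 + q ^ 2 + r ^ 2 := by
  induction α using Nat.strong_induction_on with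
  | _ α ihα =>
  intro δ
  induction δ using Nat.strong_induction_on with
  | _ δ ihδ =>
  -- the case of a size-reduced basis, reached in general by the substitution at the end
  have key : ∀ (a b c d e f : ℤ),
      a = α → a * b - f ^ 2 = δ → 0 < a → 0 < a * b - f ^ 2 →
      a * b * c + 2 * d * e * f - a * d ^ 2 - b * e ^ 2 - c * f ^ 2 = 1 →
      2 * |a * d - e * f| ≤ a * b - f ^ 2 → 2 * |f| ≤ a →
      ∀ x y z : ℤ, ∃ p q r : ℤ,
        a * x ^ 2 + b * y ^ 2 + c * z ^ 2 + 2 * d * y * z + 2 * e * x * z + 2 * f * x * y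
          = p ^ 2 + q ^ 2 + r ^ 2 := by
    intro a b c d e f haα hδ ha hA hdet hB hf x y z
    have hAC : (a * b - f ^ 2) * (a * c - e ^ 2) = (a * d - e * f) ^ 2 + a := by
      linear_combination a * hdet
    have hb : 0 < b := by
      have : 0 < a * b := by nlinarith [sq_nonneg f]
      exact pos_of_mul_pos_right this ha.le
    have hC : 0 < a * c - e ^ 2 := by
      have : 0 < (a * b - f ^ 2) * (a * c - e ^ 2) := by rw [hAC]; positivity
      exact pos_of_mul_pos_right this hA.le
    rcases lt_or_ge (a * c - e ^ 2) (a * b - f ^ 2) with hCA | hCA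
    · -- exchanging the last two basis vectors lowers the second leading minor
      obtain ⟨p, q, r, h⟩ := ihδ (a * c - e ^ 2).toNat (by omega) a c b d f e haα (by omega) ha hC
        (by linear_combination hdet) x z y
      exact ⟨p, q, r, by linear_combination h⟩
    rcases lt_or_ge b a with hba | hba
    · -- exchanging the first two basis vectors lowers the leading coefficient
      obtain ⟨p, q, r, h⟩ := ihα b.toNat (by omega) (b * a - f ^ 2).toNat b a c e d f (by omega)
        (by rw [mul_comm b a]; omega) hb (by rw [mul_comm b a]; omega)
        (by linear_combination hdet) y x z
      exact ⟨p, q, r, by linear_combination h⟩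
    -- otherwise Hermite's inequalities leave only the identity form
    generalize hAdef : a * b - f ^ 2 = A at *
    generalize hBdef : a * d - e * f = B at *
    generalize hCdef : a * c - e ^ 2 = C at *
    have hB2 : 4 * B ^ 2 ≤ A ^ 2 := by
      have := pow_le_pow_left₀ (by positivity) hB 2
      rw [mul_pow, sq_abs] at this; linarith
    have hf2 : 4 * f ^ 2 ≤ a ^ 2 := by
      have := pow_le_pow_left₀ (by positivity) hf 2
      rw [mul_pow, sq_abs] at this; linarith
    have h1 : 3 * A ^ 2 ≤ 4 * a := by nlinarith
    have h2 : 3 * a ^ 2 ≤ 4 * A := by nlinarith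
    have ha1 : a = 1 := by
      by_contra hne
      have : 2 ≤ a := by omega
      nlinarith
    subst ha1
    have hA1 : A = 1 := by nlinarith
    subst hA1
    have hf0 : f = 0 := by rw [← abs_eq_zero]; have := abs_nonneg f; omega
    have hB0 : B = 0 := by rw [← abs_eq_zero]; have := abs_nonneg B; omega
    subst hf0
    have hd0 : d = 0 := by linarith
    have hb1 : b = 1 := by linarith
    subst hd0; subst hb1
    exact ⟨x + e * z, y, z, by linear_combination z ^ 2 * hdet⟩
  intro a b c d e f haα hδ ha hA hdet x y z
  obtain ⟨k, hk⟩ := Int.exists_two_mul_abs_add_mul_le (a * d - e * f) hA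
  obtain ⟨l, hl⟩ := Int.exists_two_mul_abs_add_mul_le f ha
  -- replace the second basis vector by `e₂ + l e₁`, the third by `e₃ + k e₂`
  have hA' : a * (b + 2 * l * f + l ^ 2 * a) - (f + l * a) ^ 2 = a * b - f ^ 2 := by ring
  have hB' : a * ((d + k * b) + l * (e + k * f)) - (e + k * f) * (f + l * a)
      = a * d - e * f + k * (a * b - f ^ 2) := by ring
  obtain ⟨p, q, r, h⟩ := key a (b + 2 * l * f + l ^ 2 * a) (c + 2 * k * d + k ^ 2 * b)
    ((d + k * b) + l * (e + k * f)) (e + k * f) (f + l * a) haα (by rw [hA', hδ]) ha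
    (by rw [hA']; exact hA) (by linear_combination hdet) (by rw [hA', hB']; exact hk) hl
    (x - l * (y - k * z)) (y - k * z) z
  exact ⟨p, q, r, by linear_combination h⟩

/-! ### The three-square theorem -/

/-- If `-d` is a square modulo `d * n - 1`, then `n` is the last coefficient of a ternary form of
determinant one, so it is a sum of three squares. -/
theorem exists_three_squares_of_dvd {n d s : ℤ} (hd : 0 < d) (hb : 0 < d * n - 1)
    (h : d * n - 1 ∣ s ^ 2 + d) : ∃ p q r : ℤ, n = p ^ 2 + q ^ 2 + r ^ 2 := by
  obtain ⟨a, ha⟩ := h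
  have ha0 : 0 < a := by
    have : 0 < (d * n - 1) * a := by rw [← ha]; positivity
    exact pos_of_mul_pos_right this hb.le
  have hA : a * (d * n - 1) - s ^ 2 = d := by linear_combination -ha
  obtain ⟨p, q, r, h⟩ := exists_three_squares_of_ternary_det_one a.toNat
    (a * (d * n - 1) - s ^ 2).toNat a (d * n - 1) n 0 1 s (by omega) (by omega) ha0
    (by omega) (by linear_combination n * hA) 0 0 1
  exact ⟨p, q, r, by linear_combination h⟩

theorem exists_prime_dvd_sq_add {p d : ℕ} [Fact p.Prime] (h : J(-(d : ℤ) | p) = 1) :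
    ∃ s : ℤ, (p : ℤ) ∣ s ^ 2 + d := by
  obtain ⟨t, ht⟩ := ZMod.isSquare_of_jacobiSym_eq_one h
  refine ⟨t.val, (ZMod.intCast_zmod_eq_zero_iff_dvd _ _).1 ?_⟩
  push_cast at ht ⊢
  rw [ZMod.natCast_zmod_val, sq, ← ht]
  ring

/-- A prime `p = d * n - 1` with `d = p = 1` modulo `4` satisfies `(-d / p) = (p / d) = (-1 / d)`,
which is `1`. -/
theorem Nat.exists_three_squares_of_mod_four_eq_two {n : ℕ} (hn : n % 4 = 2) :
    ∃ p q r : ℤ, (n : ℤ) = p ^ 2 + q ^ 2 + r ^ 2 := by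
  have hcop : (n - 1).Coprime (4 * n) := by
    refine Nat.Coprime.mul_right ?_ ?_
    · rw [show 4 = 2 ^ 2 by norm_num]
      exact Nat.Coprime.pow_right _ (Nat.coprime_two_right.2 (Nat.odd_iff.2 (by omega)))
    · have := Nat.coprime_self_add_right (m := n - 1) (n := 1)
      rw [Nat.sub_add_cancel (by omega)] at this
      exact this.2 (by simp)
  obtain ⟨p, hpn, hp, hmod⟩ := Nat.forall_exists_prime_gt_and_modEq (4 * n) (by omega) hcop
  have : Fact p.Prime := ⟨hp⟩
  obtain ⟨j, hj⟩ := (Nat.modEq_iff_dvd' (by omega)).1 hmod.symm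
  have hpj : p + 1 = (4 * j + 1) * n := by
    have : (4 * j + 1) * n = 4 * n * j + n := by ring
    omega
  have hp4 : p % 4 = 1 := by
    have : (4 * j + 1) * n = 4 * (n * j) + n := by ring
    omega
  have hpz : ((4 * j + 1 : ℕ) : ℤ) * n - 1 = p := by
    rw [sub_eq_iff_eq_add]; exact_mod_cast hpj.symm
  have hJ : J(-((4 * j + 1 : ℕ) : ℤ) | p) = 1 := by
    rw [jacobiSym.neg _ (Nat.odd_iff.2 (by omega)), ZMod.χ₄_nat_one_mod_four hp4, one_mul,
      jacobiSym.quadratic_reciprocity_one_mod_four' (Nat.odd_iff.2 (by omega)) hp4,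
      jacobiSym.mod_left' (a₂ := -1), jacobiSym.at_neg_one (Nat.odd_iff.2 (by omega)),
      ZMod.χ₄_nat_one_mod_four (by omega)]
    exact Int.modEq_iff_dvd.2 ⟨-n, by linear_combination hpz⟩
  obtain ⟨s, hs⟩ := exists_prime_dvd_sq_add hJ
  exact exists_three_squares_of_dvd (d := (4 * j + 1 : ℕ)) (s := s) (by positivity)
    (by rw [hpz]; exact_mod_cast hp.pos) (by rw [hpz]; exact hs)

/-- If `c * n = 3` modulo `4`, Dirichlet's theorem yields a prime `p` with `2 * p + 1 = d * n` and
`d = c` modulo `8`. A square root of `-d` modulo `p` then lifts to one modulo `2 * p`. -/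
theorem exists_three_squares_of_two_mul_prime {n c : ℕ} (hcn : (c * n) % 4 = 3)
    (hJ : ∀ p d : ℕ, 2 * p + 1 = d * n → d % 8 = c % 8 →
      p % 4 = (c * n - 1) / 2 % 4 → J(-(d : ℤ) | p) = 1) :
    ∃ p q r : ℤ, (n : ℤ) = p ^ 2 + q ^ 2 + r ^ 2 := by
  have hn0 : n ≠ 0 := by rintro rfl; simp at hcn
  have hc2 : c % 2 = 1 := by
    rcases Nat.mod_two_eq_zero_or_one c with h | h
    · have := (Nat.dvd_of_mod_eq_zero h).mul_right n
      omega
    · exact h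
  have hcop : ((c * n - 1) / 2).Coprime (4 * n) := by
    refine Nat.Coprime.mul_right ?_ ?_
    · rw [show 4 = 2 ^ 2 by norm_num]
      exact Nat.Coprime.pow_right _ (Nat.coprime_two_right.2 (Nat.odd_iff.2 (by omega)))
    · refine Nat.Coprime.coprime_dvd_left (k := c * n - 1) ⟨2, by omega⟩ ?_
      refine Nat.Coprime.coprime_dvd_right (m := c * n) (Dvd.intro_left c rfl) ?_
      have := Nat.coprime_self_add_right (m := c * n - 1) (n := 1)
      rw [Nat.sub_add_cancel (by omega)] at this
      exact this.2 (by simp)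
  obtain ⟨p, hpn, hp, hmod⟩ :=
    Nat.forall_exists_prime_gt_and_modEq ((c * n - 1) / 2 + 2) (by omega) hcop
  have : Fact p.Prime := ⟨hp⟩
  obtain ⟨j, hj⟩ := (Nat.modEq_iff_dvd' (by omega)).1 hmod.symm
  have hpj : 2 * p + 1 = (8 * j + c) * n := by
    have : (8 * j + c) * n = 2 * (4 * n * j) + c * n := by ring
    omega
  obtain ⟨s, hs⟩ := exists_prime_dvd_sq_add (hJ p (8 * j + c) hpj (by omega)
    (by rw [mul_assoc] at hj; omega))
  have hp2 : (p : ℤ) % 2 = 1 := by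
    have := hp.eq_two_or_odd
    omega
  -- one of `s`, `s + p` is odd
  obtain ⟨t, ht2, ht⟩ : ∃ t : ℤ, t % 2 = 1 ∧ (p : ℤ) ∣ t ^ 2 + (8 * j + c : ℕ) := by
    rcases Int.emod_two_eq_zero_or_one s with h | h
    · refine ⟨s + p, by omega, ?_⟩
      rw [show (s + p) ^ 2 + ((8 * j + c : ℕ) : ℤ) = s ^ 2 + (8 * j + c : ℕ) + p * (2 * s + p) by
        ring]
      exact hs.add (Dvd.intro _ rfl)
    · exact ⟨s, h, hs⟩
  have hpz : ((8 * j + c : ℕ) : ℤ) * n - 1 = 2 * p := by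
    rw [sub_eq_iff_eq_add]; exact_mod_cast hpj.symm
  refine exists_three_squares_of_dvd (d := (8 * j + c : ℕ)) (s := t) (by omega)
    (by rw [hpz]; exact_mod_cast Nat.mul_pos two_pos hp.pos) ?_
  rw [hpz]
  refine IsCoprime.mul_dvd ?_ ?_ ht
  · exact (Int.isCoprime_iff_gcd_eq_one.2 (by
      have := (Nat.coprime_two_left (n := p)).2 (Nat.odd_iff.2 (by omega))
      simpa [Int.gcd] using this))
  · have : t ^ 2 % 2 = 1 := by rw [pow_two, Int.mul_emod, ht2]; rfl
    omega

/-- In all three cases `d` is `1` or `3` modulo `8`, so that `(-d / p) = (p / d) = (-2 / d) = 1`. -/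
theorem Nat.exists_three_squares_of_odd {n : ℕ} (hn : n % 8 = 1 ∨ n % 8 = 3 ∨ n % 8 = 5) :
    ∃ p q r : ℤ, (n : ℤ) = p ^ 2 + q ^ 2 + r ^ 2 := by
  -- as `2 * p = -1` modulo `d`, the symbols of `p` and `-2` modulo `d` agree
  have flip : ∀ p d : ℕ, 2 * p + 1 = d * n → d % 8 = 1 ∨ d % 8 = 3 → J((p : ℤ) | d) = 1 := by
    intro p d h hd
    have hodd : Odd d := Nat.odd_iff.2 (by omega)
    have h2 : J(-2 | d) = 1 := by
      rw [jacobiSym.at_neg_two hodd, ZMod.χ₈'_nat_eq_if_mod_eight]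
      rw [if_neg (by omega), if_pos hd]
    have hz : 2 * (p : ℤ) + 1 = d * n := by exact_mod_cast h
    have h1 : J(-2 * (p : ℤ) | d) = 1 := by
      rw [jacobiSym.mod_left' (a₂ := 1), jacobiSym.one_left]
      exact Int.modEq_iff_dvd.2 ⟨n, by linear_combination hz⟩
    rwa [jacobiSym.mul_left, h2, one_mul] at h1
  have one : ∀ p d : ℕ, 2 * p + 1 = d * n → d % 8 = 1 ∨ d % 8 = 3 → p % 4 = 1 →
      J(-(d : ℤ) | p) = 1 := by
    intro p d h hd hp
    rw [jacobiSym.neg _ (Nat.odd_iff.2 (by omega)), ZMod.χ₄_nat_one_mod_four hp, one_mul,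
      jacobiSym.quadratic_reciprocity_one_mod_four' (Nat.odd_iff.2 (by omega)) hp]
    exact flip p d h hd
  rcases hn with hn | hn | hn
  · exact exists_three_squares_of_two_mul_prime (c := 3) (by omega)
      fun p d h hd hp => one p d h (by omega) (by omega)
  · exact exists_three_squares_of_two_mul_prime (c := 1) (by omega)
      fun p d h hd hp => one p d h (by omega) (by omega)
  · refine exists_three_squares_of_two_mul_prime (c := 3) (by omega) fun p d h hd hp => ?_
    have hp4 : p % 4 = 3 := by omega
    rw [jacobiSym.neg _ (Nat.odd_iff.2 (by omega)), ZMod.χ₄_nat_three_mod_four hp4,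
      jacobiSym.quadratic_reciprocity_three_mod_four (by omega) hp4, flip p d h (by omega)]
    norm_num

/-! ### Sums of three rational squares -/

/-- `q` is a sum of three rational squares. -/
def IsSumThreeSq (q : ℚ) : Prop := ∃ x y z : ℚ, q = x ^ 2 + y ^ 2 + z ^ 2

theorem IsSumThreeSq.mul_sq {q : ℚ} (h : IsSumThreeSq q) (t : ℚ) : IsSumThreeSq (q * t ^ 2) := by
  obtain ⟨x, y, z, rfl⟩ := h
  exact ⟨x * t, y * t, z * t, by ring⟩

theorem isSumThreeSq_natCast {n : ℕ} (hn : n % 8 = 1 ∨ n % 8 = 3 ∨ n % 8 = 5 ∨ n % 4 = 2) :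
    IsSumThreeSq n := by
  have : ∃ p q r : ℤ, (n : ℤ) = p ^ 2 + q ^ 2 + r ^ 2 := by
    by_cases h : n % 4 = 2
    · exact Nat.exists_three_squares_of_mod_four_eq_two h
    · exact Nat.exists_three_squares_of_odd (by omega)
  obtain ⟨p, q, r, h⟩ := this
  exact ⟨p, q, r, by exact_mod_cast h⟩

theorem Nat.exists_eq_four_pow_mul {n : ℕ} (hn : 0 < n) : ∃ a k : ℕ, n = 4 ^ a * k ∧ k % 4 ≠ 0 := by
  obtain ⟨a, k, hk, h⟩ := Nat.exists_eq_pow_mul_and_not_dvd hn.ne' 4 (by norm_num)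
  exact ⟨a, k, h, by omega⟩

/-- For `r = 2 * 4 ^ a * s` with `s = 7` modulo `8` the value `u = 1` is useless, since there
`4 * m + 1 - u ^ 2` is `m` times a square; one of `u = 0` and `u = 2` works, according to `m`. -/
theorem exists_isSumThreeSq_of_mod_eight_eq_seven {s m : ℕ} (hs : s % 8 = 7) (hm : 0 < m) :
    ∃ u : ℚ, IsSumThreeSq (s * m * (4 * m + 1 - u ^ 2)) := by
  obtain ⟨c, k, rfl, hk⟩ := Nat.exists_eq_four_pow_mul hm
  have h4 : ((4 ^ c * k : ℕ) : ℚ) = k * (2 ^ c) ^ 2 := by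
    push_cast; rw [← pow_mul, mul_comm c 2, pow_mul]; norm_num; ring
  have zero (h : IsSumThreeSq ((s * k * (4 * (4 ^ c * k) + 1) : ℕ) : ℚ)) :
      ∃ u : ℚ, IsSumThreeSq (s * (4 ^ c * k : ℕ) * (4 * (4 ^ c * k : ℕ) + 1 - u ^ 2)) := by
    refine ⟨0, ?_⟩
    convert h.mul_sq (2 ^ c) using 1
    push_cast at h4 ⊢
    linear_combination s * (4 * (4 ^ c * (k : ℚ)) + 1) * h4
  have two (h : IsSumThreeSq ((s * k * (4 * (4 ^ c * k) - 3) : ℕ) : ℚ)) :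
      ∃ u : ℚ, IsSumThreeSq (s * (4 ^ c * k : ℕ) * (4 * (4 ^ c * k : ℕ) + 1 - u ^ 2)) := by
    refine ⟨2, ?_⟩
    convert h.mul_sq (2 ^ c) using 1
    rw [Nat.cast_mul (s * k), Nat.cast_sub (by omega)]
    push_cast at h4 ⊢
    linear_combination s * (4 * (4 ^ c * (k : ℚ)) - 3) * h4
  have mod8 (A B C : ℕ) {α β γ : ℕ} (hA : A % 8 = α) (hB : B % 8 = β) (hC : C % 8 = γ) :
      (A * B * C) % 8 = (α * β * γ) % 8 := by
    rw [← hA, ← hB, ← hC]; simp [Nat.mul_mod]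
  have hk8 : k % 8 = 1 ∨ k % 8 = 2 ∨ k % 8 = 3 ∨ k % 8 = 5 ∨ k % 8 = 6 ∨ k % 8 = 7 := by omega
  rcases Nat.eq_zero_or_pos c with rfl | hc
  · simp only [pow_zero, one_mul] at zero two ⊢
    rcases hk8 with h | h | h | h | h | h
    · have := mod8 s k (4 * k + 1) hs h (γ := 5) (by omega)
      exact zero (isSumThreeSq_natCast (by omega))
    · have := mod8 s k (4 * k + 1) hs h (γ := 1) (by omega)
      exact zero (isSumThreeSq_natCast (by omega))
    · have := mod8 s k (4 * k + 1) hs h (γ := 5) (by omega)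
      exact zero (isSumThreeSq_natCast (by omega))
    · have := mod8 s k (4 * k - 3) hs h (γ := 1) (by omega)
      exact two (isSumThreeSq_natCast (by omega))
    · have := mod8 s k (4 * k + 1) hs h (γ := 1) (by omega)
      exact zero (isSumThreeSq_natCast (by omega))
    · have := mod8 s k (4 * k + 1) hs h (γ := 5) (by omega)
      exact zero (isSumThreeSq_natCast (by omega))
  · obtain ⟨w, hw⟩ : 4 ∣ 4 ^ c * k := (dvd_pow_self 4 hc.ne').mul_right k
    rw [hw] at zero two hm ⊢
    rcases hk8 with h | h | h | h | h | h
    · have := mod8 s k (4 * (4 * w) - 3) hs h (γ := 5) (by omega)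
      exact two (isSumThreeSq_natCast (by omega))
    all_goals
      have := mod8 s k (4 * (4 * w) + 1) hs h (γ := 1) (by omega)
      exact zero (isSumThreeSq_natCast (by omega))

/-- Modulo squares the value at `u = 1` is `2 * r`, which is a sum of three squares unless `r` is
`2 * 4 ^ a * s` with `s = 7` modulo `8`. -/
theorem exists_isSumThreeSq_two_mul {r m : ℕ} (hr : 0 < r) (hm : 0 < m) :
    ∃ u : ℚ, IsSumThreeSq (2 * r * m * (4 * m + 1 - u ^ 2)) := by
  obtain ⟨a, k, rfl, hk⟩ := Nat.exists_eq_four_pow_mul hr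
  have h4 : ((4 ^ a * k : ℕ) : ℚ) = k * (2 ^ a) ^ 2 := by
    push_cast; rw [← pow_mul, mul_comm a 2, pow_mul]; norm_num; ring
  rw [h4]
  by_cases hodd : k % 2 = 1
  · refine ⟨1, ?_⟩
    convert (isSumThreeSq_natCast (n := 2 * k) (by omega)).mul_sq (2 * 2 ^ a * m) using 1
    push_cast; ring
  obtain ⟨s, rfl⟩ : 2 ∣ k := by omega
  by_cases hs : s % 8 = 7
  · obtain ⟨u, hu⟩ := exists_isSumThreeSq_of_mod_eight_eq_seven hs hm
    refine ⟨u, ?_⟩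
    convert hu.mul_sq (2 * 2 ^ a) using 1
    push_cast; ring
  · refine ⟨1, ?_⟩
    convert (isSumThreeSq_natCast (n := s) (by omega)).mul_sq (4 * 2 ^ a * m) using 1
    push_cast; ring

/-- Clearing the denominator of `x = u / (4 * m)` turns the equation into
`exists_isSumThreeSq_two_mul`. -/
theorem exists_diophantine_solution {r m : ℕ} (hr : 0 < r) (hm : 0 < m) :
    ∃ x y z w : ℚ, (r : ℚ) * (4 * (m : ℚ) - 1) / (8 * (m : ℚ)) + 2 * (r : ℚ) * (m : ℚ) * x ^ 2
      + y ^ 2 + z ^ 2 + w ^ 2 = (r : ℚ) := by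
  obtain ⟨u, y, z, w, h⟩ := exists_isSumThreeSq_two_mul hr hm
  have hm' : (m : ℚ) ≠ 0 := by positivity
  refine ⟨u / (4 * m), y / (4 * m), z / (4 * m), w / (4 * m), ?_⟩
  field_simp
  linear_combination -8 * h

theorem exists_diophantine_solution_rat {r : ℚ} {m : ℕ} (hr : 0 < r) (hm : 0 < m) :
    ∃ x y z w : ℚ, r * (4 * (m : ℚ) - 1) / (8 * (m : ℚ)) + 2 * r * (m : ℚ) * x ^ 2
      + y ^ 2 + z ^ 2 + w ^ 2 = r := by
  obtain ⟨x, y, z, w, h⟩ := exists_diophantine_solution (r := r.num.toNat * r.den)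
    (Nat.mul_pos (by have := Rat.num_pos.2 hr; omega) r.den_pos) hm
  have hd : (r.den : ℚ) ≠ 0 := by exact_mod_cast r.den_ne_zero
  have hrd : ((r.num.toNat * r.den : ℕ) : ℚ) = r * (r.den : ℚ) ^ 2 := by
    have h1 : ((r.num.toNat : ℕ) : ℚ) = (r.num : ℚ) := by
      exact_mod_cast Int.toNat_of_nonneg (Rat.num_pos.2 hr).le
    rw [Nat.cast_mul, h1, ← Rat.mul_den_eq_num r]; ring
  have hm' : (m : ℚ) ≠ 0 := by positivity
  rw [hrd] at h
  refine ⟨x, y / r.den, z / r.den, w / r.den, ?_⟩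
  field_simp at h ⊢
  linear_combination h

/-! ### Regular simplices with rational vertices -/

/-- The Gram matrix of a regular simplex centred at the origin. -/
theorem sum_mul_of_centered_equidistant {ι κ : Type*} [Fintype ι] [DecidableEq ι] [Nonempty ι]
    [Fintype κ] {r : ℚ} {q : ι → κ → ℚ} (hsum : ∀ t, ∑ i, q i t = 0)
    (h : ∀ i j, i ≠ j → ∑ t, (q i t - q j t) ^ 2 = r) (i j : ι) :
    ∑ t, q i t * q j t = r / 2 * ((if i = j then 1 else 0) - 1 / Fintype.card ι) := by
  have hk : (Fintype.card ι : ℚ) ≠ 0 := by exact_mod_cast Fintype.card_ne_zero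
  have hsum' (i : ι) : ∑ j, ∑ t, q i t * q j t = 0 := by
    rw [Finset.sum_comm]
    simp [← Finset.mul_sum, hsum]
  have hd (i j : ι) : ∑ t, q i t * q i t + ∑ t, q j t * q j t - 2 * ∑ t, q i t * q j t
      = r * (1 - if i = j then 1 else 0) := by
    rw [Finset.mul_sum, ← Finset.sum_add_distrib, ← Finset.sum_sub_distrib]
    by_cases hij : i = j
    · subst hij
      simp only [if_true, sub_self, mul_zero]
      exact Finset.sum_eq_zero fun t _ => by ring
    · rw [if_neg hij, sub_zero, mul_one, ← h i j hij]
      exact Finset.sum_congr rfl fun t _ => by ring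
  -- summing the distances from one vertex, then from all vertices, yields the circumradius
  have h1 (i : ι) : Fintype.card ι * ∑ t, q i t * q i t + ∑ j, ∑ t, q j t * q j t
      = r * (Fintype.card ι - 1) := by
    have := Finset.sum_congr rfl fun j (_ : j ∈ Finset.univ) => hd i j
    rw [Finset.sum_sub_distrib, Finset.sum_add_distrib, ← Finset.mul_sum, hsum' i,
      ← Finset.mul_sum, Finset.sum_sub_distrib] at this
    simpa using this
  have h2 : 2 * ∑ j, ∑ t, q j t * q j t = r * (Fintype.card ι - 1) := by
    have := Finset.sum_congr rfl fun i (_ : i ∈ Finset.univ) => h1 i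
    rw [Finset.sum_add_distrib, ← Finset.mul_sum] at this
    simp only [Finset.sum_const, Finset.card_univ, nsmul_eq_mul] at this
    apply mul_left_cancel₀ hk
    linear_combination this
  have h3 (i : ι) : ∑ t, q i t * q i t = r / 2 * (1 - 1 / Fintype.card ι) := by
    have := h1 i
    generalize ∑ t, q i t * q i t = g at *
    field_simp
    linear_combination 2 * this - h2
  have := hd i j
  rw [h3, h3] at this
  linear_combination -this / 2

open Matrix in
/-- Adding a normal vector `v` to all vertices of the simplex yields a square matrix whose Gram
determinant is known, so that `|v|²` is determined up to a square. -/
theorem sq_det_add_normal {ι : Type*} [Fintype ι] [DecidableEq ι] [Nonempty ι]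
    {r : ℚ} (hr : 0 < r) {q : Matrix ι ι ℚ} {v : ι → ℚ} (hv : q *ᵥ v = 0)
    (hq : ∀ i j, ∑ t, q i t * q j t = r / 2 * ((if i = j then 1 else 0) - 1 / Fintype.card ι)) :
    (q + Matrix.of fun _ t => v t).det ^ 2
      = (r / 2) ^ (Fintype.card ι - 1) * Fintype.card ι * ∑ t, v t ^ 2 := by
  have hk : (Fintype.card ι : ℚ) ≠ 0 := by exact_mod_cast Fintype.card_ne_zero
  set N : ℚ := ∑ t, v t ^ 2 with hN
  set M := q + Matrix.of fun _ t => v t with hM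
  have hqv (i : ι) : ∑ t, q i t * v t = 0 := congrFun hv i
  have hMM : M * Mᵀ = (r / 2) • (1 + replicateCol Unit (fun _ : ι => 2 * N / r - 1 / Fintype.card ι)
      * replicateRow Unit (fun _ : ι => (1 : ℚ))) := by
    ext i j
    have : (M * Mᵀ) i j = ∑ t, q i t * q j t + ∑ t, q i t * v t + ∑ t, q j t * v t + N := by
      rw [Matrix.mul_apply, hN, ← Finset.sum_add_distrib, ← Finset.sum_add_distrib,
        ← Finset.sum_add_distrib]
      refine Finset.sum_congr rfl fun t _ => ?_
      simp only [hM, Matrix.transpose_apply, Matrix.add_apply, Matrix.of_apply]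
      ring
    rw [this, hqv, hqv, hq]
    simp only [Matrix.smul_apply, Matrix.add_apply, Matrix.mul_apply, Matrix.one_apply,
      replicateCol_apply, replicateRow_apply, Finset.univ_unique, Finset.sum_singleton, smul_eq_mul]
    field_simp
    ring
  have hdet := congrArg Matrix.det hMM
  rw [Matrix.det_mul, Matrix.det_transpose, Matrix.det_smul,
    det_one_add_replicateCol_mul_replicateRow] at hdet
  simp only [dotProduct, one_mul, Finset.sum_const, Finset.card_univ, nsmul_eq_mul] at hdet
  rw [sq, hdet, ← Nat.sub_add_cancel (Fintype.card_pos (α := ι)), pow_succ,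
    Nat.sub_add_cancel (Fintype.card_pos (α := ι))]
  field_simp
  ring

/-- A regular simplex with `4 m` rational vertices and edge `√r` has a rational normal vector of
squared length `2 r m`. -/
theorem exists_normal_of_equidistant {ι : Type*} [Fintype ι] [DecidableEq ι] {m : ℕ} (hm : 0 < m)
    (hι : Fintype.card ι = 4 * m) {r : ℚ} (hr : 0 < r) {q : Matrix ι ι ℚ}
    (hsum : ∀ t, ∑ i, q i t = 0)
    (hq : ∀ i j, ∑ t, q i t * q j t = r / 2 * ((if i = j then 1 else 0) - 1 / Fintype.card ι)) :
    ∃ w : ι → ℚ, (∀ i, ∑ t, q i t * w t = 0) ∧ ∑ t, w t ^ 2 = 2 * r * m := by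
  have : Nonempty ι := Fintype.card_pos_iff.1 (by omega)
  have hm' : (m : ℚ) ≠ 0 := by positivity
  have hdet : q.det = 0 := by
    refine Matrix.exists_vecMul_eq_zero_iff.1 ⟨fun _ => 1, ?_, ?_⟩
    · exact fun h => one_ne_zero (congrFun h (Classical.arbitrary ι))
    · ext t; simpa [Matrix.vecMul, dotProduct] using hsum t
  obtain ⟨v, hv0, hv⟩ := Matrix.exists_mulVec_eq_zero_iff.2 hdet
  have hsq := sq_det_add_normal hr hv hq
  generalize (q + Matrix.of fun _ t => v t).det = D at hsq
  have hN : 0 < ∑ t, v t ^ 2 := by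
    obtain ⟨t, ht⟩ := Function.ne_iff.1 hv0
    exact Finset.sum_pos' (fun _ _ => sq_nonneg _) ⟨t, Finset.mem_univ _, sq_pos_of_ne_zero ht⟩
  -- the exponent `4 m - 1` is odd, so `2 r m |v|²` is a square
  set E : ℚ := D / (r / 2) ^ (2 * m - 1) with hE
  have hE2 : E ^ 2 = 2 * r * m * ∑ t, v t ^ 2 := by
    have : (r / 2) ^ (4 * m - 1) = ((r / 2) ^ (2 * m - 1)) ^ 2 * (r / 2) := by
      rw [← pow_mul, ← pow_succ]; congr 1; omega
    rw [hE, div_pow, hsq, hι, this]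
    push_cast
    field_simp
    ring
  have hE0 : E ≠ 0 := by
    intro h
    rw [h] at hE2
    have : 0 < 2 * r * m * ∑ t, v t ^ 2 := by positivity
    rw [← hE2] at this
    norm_num at this
  refine ⟨fun t => 2 * r * m / E * v t, fun i => ?_, ?_⟩
  · have : ∑ t, q i t * v t = 0 := congrFun hv i
    calc ∑ t, q i t * (2 * r * m / E * v t) = 2 * r * m / E * ∑ t, q i t * v t := by
          rw [Finset.mul_sum]; exact Finset.sum_congr rfl fun t _ => by ring
      _ = 0 := by rw [this, mul_zero]
  · simp only [mul_pow, ← Finset.mul_sum]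
    rw [div_pow, div_mul_eq_mul_div, div_eq_iff (pow_ne_zero _ hE0), hE2]
    ring

/-- The point with coordinates `o + x w` and `y, z, w'`, where `o` is the centre and `w` the normal
vector, is at the right distance because of `exists_diophantine_solution_rat`. -/
theorem exists_apex_of_equidistant {ι : Type*} [Fintype ι] [DecidableEq ι] {m : ℕ} (hm : 0 < m)
    (hι : Fintype.card ι = 4 * m) {r : ℚ} (hr : 0 < r) {p : ι → ι → ℚ}
    (h : ∀ i j, i ≠ j → ∑ t, (p i t - p j t) ^ 2 = r) :
    ∃ (a : ι → ℚ) (b : Fin 3 → ℚ), ∀ i, ∑ t, (a t - p i t) ^ 2 + ∑ t, b t ^ 2 = r := by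
  have : Nonempty ι := Fintype.card_pos_iff.1 (by omega)
  have hm' : (m : ℚ) ≠ 0 := by positivity
  have hk : (Fintype.card ι : ℚ) ≠ 0 := by exact_mod_cast Fintype.card_ne_zero
  let o : ι → ℚ := fun t => (∑ i, p i t) / Fintype.card ι
  let q : ι → ι → ℚ := fun i t => p i t - o t
  have hsum (t : ι) : ∑ i, q i t = 0 := by
    simp only [q, o, Finset.sum_sub_distrib, Finset.sum_const, Finset.card_univ, nsmul_eq_mul]
    field_simp
    ring
  have hq := sum_mul_of_centered_equidistant (r := r) (q := q) hsum fun i j hij => by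
    rw [← h i j hij]; exact Finset.sum_congr rfl fun t _ => by simp only [q]; ring
  obtain ⟨w, hw, hw2⟩ := exists_normal_of_equidistant hm hι hr hsum hq
  obtain ⟨x, y, z, u, hs⟩ := exists_diophantine_solution_rat hr hm
  refine ⟨fun t => o t + x * w t, ![y, z, u], fun i => ?_⟩
  have h1 : ∑ t, (o t + x * w t - p i t) ^ 2
      = ∑ t, q i t * q i t - 2 * x * ∑ t, q i t * w t + x ^ 2 * ∑ t, w t ^ 2 := by
    rw [Finset.mul_sum, Finset.mul_sum, ← Finset.sum_sub_distrib, ← Finset.sum_add_distrib]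
    exact Finset.sum_congr rfl fun t _ => by simp only [q]; ring
  rw [h1, hq, hw, hw2, hι, Fin.sum_univ_three]
  simp only [if_true, Matrix.cons_val]
  have h2 : r / 2 * (1 - 1 / ((4 * m : ℕ) : ℚ)) = r * (4 * m - 1) / (8 * m) := by
    push_cast
    field_simp
    ring
  linear_combination h2 + hs

/-! ### Rational points and the distance graph -/

/-- The point of `ℚⁿ ⊆ ℝⁿ` with the given rational coordinates. -/
def ratPoint {n : ℕ} (a : Fin n → ℚ) : PointsIn rationals n :=
  ⟨WithLp.toLp 2 fun i => (a i : ℝ), fun i => ⟨a i, rfl⟩⟩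

theorem exists_ratPoint_eq {n : ℕ} (x : PointsIn rationals n) : ∃ a, ratPoint a = x := by
  choose a ha using x.2
  refine ⟨a, Subtype.ext ?_⟩
  ext i
  exact ha i

theorem padZeros_ratPoint {n : ℕ} (k : ℕ) (a : Fin n → ℚ) :
    padZeros k (ratPoint a) = ratPoint (Fin.append a fun _ : Fin k => 0) := by
  refine Subtype.ext ?_
  ext i
  refine Fin.addCases (fun j => ?_) (fun j => ?_) i <;> simp [padZeros, ratPoint]

theorem dist_ratPoint {n : ℕ} (a b : Fin n → ℚ) :
    dist (ratPoint a) (ratPoint b) = √((∑ t, (a t - b t) ^ 2 : ℚ) : ℝ) := by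
  rw [Subtype.dist_eq, EuclideanSpace.dist_eq]
  simp [ratPoint, Real.dist_eq, sq_abs]

theorem distanceGraph_adj_ratPoint {n : ℕ} {r : ℚ} (hr : 0 < r) (a b : Fin n → ℚ) :
    (distanceGraph rationals n √(r : ℝ)).Adj (ratPoint a) (ratPoint b) ↔
      ∑ t, (a t - b t) ^ 2 = r := by
  have h : dist (ratPoint a) (ratPoint b) = √(r : ℝ) ↔ ∑ t, (a t - b t) ^ 2 = r := by
    rw [dist_ratPoint, Real.sqrt_inj (by positivity) (by positivity), Rat.cast_inj]
  refine ⟨fun hab => h.1 hab.2, fun hab => ⟨fun he => ?_, h.2 hab⟩⟩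
  have := h.2 hab
  rw [he, dist_self] at this
  exact (Real.sqrt_pos.2 (Rat.cast_pos.2 hr)).ne this

/-! ### Bounds for the clique number -/

/-- The Gram matrix of such a family is `d ^ 2 / 2` times the identity plus the all-ones matrix,
which is invertible. -/
theorem linearIndependent_of_equidistant {E ι : Type*} [NormedAddCommGroup E]
    [InnerProductSpace ℝ E] [Fintype ι] {d : ℝ} (hd : 0 < d) {v : ι → E} (h0 : ∀ i, ‖v i‖ = d)
    (h : ∀ i j, i ≠ j → ‖v i - v j‖ = d) : LinearIndependent ℝ v := by
  classical
  have hinner (i j : ι) : inner ℝ (v i) (v j) = d ^ 2 / 2 * (1 + if i = j then 1 else 0) := by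
    by_cases hij : i = j
    · subst hij
      rw [real_inner_self_eq_norm_sq, h0, if_pos rfl]; ring
    · have := norm_sub_sq_real (v i) (v j)
      rw [h i j hij, h0, h0] at this
      rw [if_neg hij]; linarith
  rw [Fintype.linearIndependent_iff]
  intro g hg
  have hj (j : ι) : g j = -∑ i, g i := by
    have : inner ℝ (∑ i, g i • v i) (v j) = d ^ 2 / 2 * (∑ i, g i + g j) := by
      have hterm (i : ι) : inner ℝ (g i • v i) (v j)
          = d ^ 2 / 2 * (g i + if i = j then g i else 0) := by
        rw [real_inner_smul_left, hinner]
        split_ifs <;> ring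
      rw [sum_inner, Finset.sum_congr rfl fun i _ => hterm i, ← Finset.mul_sum,
        Finset.sum_add_distrib, Finset.sum_ite_eq' Finset.univ j g, if_pos (Finset.mem_univ j)]
    rw [hg, inner_zero_left] at this
    have h2 := (mul_eq_zero.1 this.symm).resolve_left (half_pos (pow_pos hd 2)).ne'
    linarith
  have hsum : ∑ i, g i = 0 := by
    have := Finset.sum_congr rfl fun j (_ : j ∈ Finset.univ) => hj j
    rw [Finset.sum_const, nsmul_eq_mul] at this
    have h1 : (1 + ((Finset.univ : Finset ι).card : ℝ)) * ∑ i, g i = 0 := by linarith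
    exact (mul_eq_zero.1 h1).resolve_left
      (add_pos_of_pos_of_nonneg one_pos (Nat.cast_nonneg _)).ne'
  intro i
  rw [hj, hsum, neg_zero]

theorem card_le_of_isNClique {n k : ℕ} {d : ℝ} (hd : 0 < d) {S : Set ℝ}
    {s : Finset (PointsIn S n)} (hs : (distanceGraph S n d).IsNClique k s) : k ≤ n + 1 := by
  classical
  rw [← hs.card_eq]
  rcases s.eq_empty_or_nonempty with rfl | ⟨x, hx⟩
  · simp
  have hadj {y z : PointsIn S n} (hy : y ∈ s) (hz : z ∈ s) (h : y ≠ z) : dist y.1 z.1 = d :=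
    (hs.isClique hy hz h).2
  have hli : LinearIndependent ℝ fun y : s.erase x => y.1.1 - x.1 := by
    refine linearIndependent_of_equidistant hd (fun y => ?_) fun y z hyz => ?_
    · rw [← dist_eq_norm]
      exact hadj (Finset.mem_of_mem_erase y.2) hx (Finset.ne_of_mem_erase y.2)
    · rw [sub_sub_sub_cancel_right, ← dist_eq_norm]
      exact hadj (Finset.mem_of_mem_erase y.2) (Finset.mem_of_mem_erase z.2)
        fun h => hyz (Subtype.ext h)
  have := hli.fintype_card_le_finrank
  rw [finrank_euclideanSpace_fin, Fintype.card_coe, Finset.card_erase_of_mem hx] at this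
  omega

theorem isGreatest_cliqueNum (S : Set ℝ) (n : ℕ) {d : ℝ} (hd : 0 < d) :
    IsGreatest {k : ℕ | ∃ s : Finset (PointsIn S n), (distanceGraph S n d).IsNClique k s}
      (distanceGraph S n d).cliqueNum :=
  ⟨(distanceGraph S n d).exists_isNClique_cliqueNum,
    fun _ hk => le_csSup ⟨n + 1, fun _ ⟨_, hs⟩ => card_le_of_isNClique hd hs⟩ hk⟩

theorem cliqueNum_le (S : Set ℝ) (n : ℕ) {d : ℝ} (hd : 0 < d) :
    (distanceGraph S n d).cliqueNum ≤ n + 1 :=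
  let ⟨_, hs⟩ := (isGreatest_cliqueNum S n hd).1
  card_le_of_isNClique hd hs

theorem card_le_cliqueNum_of_equidistant {ι : Type*} [Fintype ι] {n : ℕ} {r : ℚ} (hr : 0 < r)
    {a : ι → Fin n → ℚ} (h : ∀ i j, i ≠ j → ∑ t, (a i t - a j t) ^ 2 = r) :
    Fintype.card ι ≤ (distanceGraph rationals n √(r : ℝ)).cliqueNum := by
  classical
  have hadj (i j : ι) (hij : i ≠ j) :=
    (distanceGraph_adj_ratPoint hr (a i) (a j)).2 (h i j hij)
  have hinj : Function.Injective fun i => ratPoint (a i) := fun i j hij => by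
    by_contra hne
    exact (hadj i j hne).1 hij
  refine (isGreatest_cliqueNum rationals n (Real.sqrt_pos.2 (Rat.cast_pos.2 hr))).2
    ⟨Finset.univ.image fun i => ratPoint (a i), ?_, ?_⟩
  · intro x hx y hy hxy
    simp only [Finset.coe_image, Finset.coe_univ, Set.image_univ, Set.mem_range] at hx hy
    obtain ⟨i, rfl⟩ := hx
    obtain ⟨j, rfl⟩ := hy
    exact hadj i j fun hij => hxy (by rw [hij])
  · rw [Finset.card_image_of_injective _ hinj, Finset.card_univ]

theorem Rat.exists_four_squares {r : ℚ} (hr : 0 < r) :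
    ∃ a b c d : ℚ, a ^ 2 + b ^ 2 + c ^ 2 + d ^ 2 = r := by
  obtain ⟨a, b, c, d, h⟩ := Nat.sum_four_squares (r.num.toNat * r.den)
  have hd : (r.den : ℚ) ≠ 0 := by exact_mod_cast r.den_ne_zero
  have h1 : ((r.num.toNat : ℕ) : ℚ) = (r.num : ℚ) := by
    exact_mod_cast Int.toNat_of_nonneg (Rat.num_pos.2 hr).le
  have h2 : (a : ℚ) ^ 2 + b ^ 2 + c ^ 2 + d ^ 2 = r.num * r.den := by
    rw [← h1]; exact_mod_cast h
  refine ⟨a / r.den, b / r.den, c / r.den, d / r.den, ?_⟩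
  rw [← Rat.mul_den_eq_num r] at h2
  field_simp
  linear_combination h2

/-- The matrix of a quaternion of norm `h` has orthogonal rows of squared length `h`. -/
theorem exists_orthogonal_rows {h : ℚ} (hh : 0 < h) :
    ∃ M : Fin 4 → Fin 4 → ℚ, ∀ i j, ∑ t, M i t * M j t = if i = j then h else 0 := by
  obtain ⟨a, b, c, d, rfl⟩ := Rat.exists_four_squares hh
  refine ⟨![![a, b, c, d], ![-b, a, -d, c], ![-c, d, a, -b], ![-d, -c, b, a]], fun i j => ?_⟩
  fin_cases i <;> fin_cases j <;> simp [Fin.sum_univ_four] <;> ring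

/-- In dimension divisible by four every rational squared distance occurs in a clique whose size is
the dimension: the rows of a block diagonal matrix with equal quaternionic blocks. -/
theorem exists_equidistant_four_mul (m : ℕ) {r : ℚ} (hr : 0 < r) :
    ∃ p : Fin (4 * m) → Fin (4 * m) → ℚ, ∀ i j, i ≠ j → ∑ t, (p i t - p j t) ^ 2 = r := by
  obtain ⟨M, hM⟩ := exists_orthogonal_rows (half_pos hr)
  let q : Fin 4 × Fin m → Fin 4 × Fin m → ℚ := fun x y => if x.2 = y.2 then M x.1 y.1 else 0
  have hq (x y : Fin 4 × Fin m) : ∑ t, q x t * q y t = if x = y then r / 2 else 0 := by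
    rw [Fintype.sum_prod_type]
    simp only [q, ite_mul, zero_mul, mul_ite, mul_zero, Finset.sum_ite_eq, Finset.mem_univ, if_true]
    by_cases h2 : y.2 = x.2
    · simp only [h2, if_true, hM, Prod.ext_iff, and_true]
    · simp only [h2, if_false, Finset.sum_const_zero, Prod.ext_iff, eq_comm (a := x.2), and_false]
  let e : Fin 4 × Fin m ≃ Fin (4 * m) := finProdFinEquiv
  refine ⟨fun i t => q (e.symm i) (e.symm t), fun i j hij => ?_⟩
  have hij' : e.symm i ≠ e.symm j := fun h => hij (e.symm.injective h)
  rw [e.symm.sum_comp fun t => (q (e.symm i) t - q (e.symm j) t) ^ 2]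
  calc ∑ t, (q (e.symm i) t - q (e.symm j) t) ^ 2
      = ∑ t, q (e.symm i) t * q (e.symm i) t + ∑ t, q (e.symm j) t * q (e.symm j) t
        - 2 * ∑ t, q (e.symm i) t * q (e.symm j) t := by
        rw [Finset.mul_sum, ← Finset.sum_add_distrib, ← Finset.sum_sub_distrib]
        exact Finset.sum_congr rfl fun t _ => by ring
    _ = r := by rw [hq, hq, hq, if_pos rfl, if_pos rfl, if_neg hij']; ring

theorem four_mul_le_cliqueNum (m j : ℕ) {r : ℚ} (hr : 0 < r) :
    4 * m ≤ (distanceGraph rationals (4 * m + j) √(r : ℝ)).cliqueNum := by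
  obtain ⟨p, hp⟩ := exists_equidistant_four_mul m hr
  have := card_le_cliqueNum_of_equidistant hr
    (a := fun i => Fin.append (p i) fun _ : Fin j => (0 : ℚ)) fun i j hij => by
      simpa [Fin.sum_univ_add] using hp i j hij
  simpa using this

theorem four_mul_add_one_le_cliqueNum {m : ℕ} (hm : 0 < m) {r : ℚ} (hr : 0 < r) :
    4 * m + 1 ≤ (distanceGraph rationals (4 * m + 3) √(r : ℝ)).cliqueNum := by
  obtain ⟨p, hp⟩ := exists_equidistant_four_mul m hr
  obtain ⟨a, b, hab⟩ := exists_apex_of_equidistant hm (by simp) hr hp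
  let f : Option (Fin (4 * m)) → Fin (4 * m + 3) → ℚ := fun o =>
    o.elim (Fin.append a b) fun i => Fin.append (p i) fun _ => 0
  have hf (i : Fin (4 * m)) : ∑ t, (f none t - f (some i) t) ^ 2 = r := by
    simpa [f, Fin.sum_univ_add] using hab i
  have := card_le_cliqueNum_of_equidistant hr (a := f) fun i j hij => by
    match i, j with
    | none, none => exact absurd rfl hij
    | none, some j => exact hf j
    | some i, none =>
      rw [← hf i]; exact Finset.sum_congr rfl fun t _ => by ring
    | some i, some j =>
      simpa [f, Fin.sum_univ_add] using hp i j fun h => hij (congrArg some h)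
  simpa using this

theorem two_le_cliqueNum {n : ℕ} {d : ℝ} (hd : 0 < d) {x y : PointsIn rationals n}
    (hxy : dist x y = d) : 2 ≤ (distanceGraph rationals n d).cliqueNum := by
  classical
  have hne : x ≠ y := by rintro rfl; rw [dist_self] at hxy; exact hd.ne hxy
  refine (isGreatest_cliqueNum rationals n hd).2 ⟨{x, y}, ?_, Finset.card_pair hne⟩
  rw [Finset.coe_pair, SimpleGraph.isClique_pair]
  exact fun _ => ⟨hne, hxy⟩

/-- For `n < 4` the two points realizing `d` suffice. -/
theorem le_cliqueNum_add_two {n : ℕ} {d : ℝ} (hd : 0 < d)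
    (h : IsRealized rationals n d) : n ≤ (distanceGraph rationals n d).cliqueNum + 2 := by
  obtain ⟨x, y, hxy⟩ := h
  rcases lt_or_ge n 4 with hn | hn
  · have := two_le_cliqueNum hd hxy
    omega
  obtain ⟨a, rfl⟩ := exists_ratPoint_eq x
  obtain ⟨b, rfl⟩ := exists_ratPoint_eq y
  rw [dist_ratPoint] at hxy
  subst hxy
  have hr := Rat.cast_pos.1 (Real.sqrt_pos.1 hd)
  generalize ∑ t, (a t - b t) ^ 2 = r at *
  obtain ⟨m, j, hj, rfl⟩ : ∃ m j, j < 4 ∧ n = 4 * m + j := ⟨n / 4, n % 4, by omega, by omega⟩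
  rcases lt_or_ge j 3 with h3 | h3
  · have := four_mul_le_cliqueNum m j hr
    omega
  · obtain rfl : j = 3 := by omega
    have := four_mul_add_one_le_cliqueNum (m := m) (by omega) hr
    omega

theorem isGreatest_upperCliqueNumber (S : Set ℝ) (n : ℕ) :
    IsGreatest (cliqueValues S n) (upperCliqueNumber S n) := by
  have hb : BddAbove (cliqueValues S n) :=
    ⟨n + 1, by rintro _ ⟨d, hd, rfl⟩; exact cliqueNum_le S n hd⟩
  exact ⟨Nat.sSup_mem ⟨_, 1, one_pos, rfl⟩ hb, fun _ hk => le_csSup hb hk⟩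

theorem isLeast_lowerCliqueNumber {n : ℕ} (hn : 0 < n) :
    IsLeast (realizedCliqueValues rationals n) (lowerCliqueNumber rationals n) := by
  refine ⟨Nat.sInf_mem ⟨_, 1, one_pos, ⟨ratPoint (Pi.single ⟨0, hn⟩ 1), ratPoint 0, ?_⟩, rfl⟩,
    fun _ hk => Nat.sInf_le hk⟩
  rw [dist_ratPoint]
  have : ∑ t, ((Pi.single ⟨0, hn⟩ 1 : Fin n → ℚ) t - (0 : Fin n → ℚ) t) ^ 2 = 1 := by
    simp [Pi.single_apply]
  rw [this]
  simp

theorem mainTheorem3 :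
    -- all the maxima and the minimum exist, and the largest and smallest clique numbers
    -- differ by at most three
    (∀ n : ℕ, 0 < n →
      (∀ d : ℝ, 0 < d →
        IsGreatest {k : ℕ | ∃ s : Finset (PointsIn rationals n),
          (distanceGraph rationals n d).IsNClique k s} (distanceGraph rationals n d).cliqueNum) ∧
      IsGreatest (cliqueValues rationals n) (upperCliqueNumber rationals n) ∧
      IsLeast (realizedCliqueValues rationals n) (lowerCliqueNumber rationals n) ∧
      (upperCliqueNumber rationals n : ℤ) - (lowerCliqueNumber rationals n : ℤ) ≤ 3) ∧
    -- every clique of size `4m` in dimension `4m` extends by a point in dimension `4m + 3`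
    (∀ (m : ℕ) (r : ℚ), 0 < m → 0 < r →
      ∀ P : Fin (4 * m) → PointsIn rationals (4 * m),
        (∀ i j, i ≠ j → (distanceGraph rationals (4 * m) (Real.sqrt r)).Adj (P i) (P j)) →
        ∃ p : PointsIn rationals (4 * m + 3),
          ∀ i, (distanceGraph rationals (4 * m + 3) (Real.sqrt r)).Adj p (padZeros 3 (P i))) ∧
    -- the associated Diophantine equation is always solvable in rationals
    (∀ r m : ℕ, 0 < r → 0 < m →
      ∃ x y z w : ℚ,
        (r : ℚ) * (4 * (m : ℚ) - 1) / (8 * (m : ℚ)) + 2 * (r : ℚ) * (m : ℚ) * x ^ 2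
          + y ^ 2 + z ^ 2 + w ^ 2 = (r : ℚ)) := by
  refine ⟨fun n hn => ⟨fun d hd => isGreatest_cliqueNum rationals n hd,
    isGreatest_upperCliqueNumber rationals n, isLeast_lowerCliqueNumber hn, ?_⟩,
    fun m r hm hr P hP => ?_, fun r m hr hm => exists_diophantine_solution hr hm⟩
  · obtain ⟨d, hd, hC⟩ := (isGreatest_upperCliqueNumber rationals n).1
    obtain ⟨d', hd', hreal, hc⟩ := (isLeast_lowerCliqueNumber hn).1
    have h1 := cliqueNum_le rationals n hd
    have h2 := le_cliqueNum_add_two hd' hreal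
    omega
  · choose p hp using fun i => exists_ratPoint_eq (P i)
    obtain rfl : (fun i => ratPoint (p i)) = P := funext hp
    obtain ⟨a, b, hab⟩ := exists_apex_of_equidistant hm (by simp) hr (p := p)
      fun i j hij => (distanceGraph_adj_ratPoint hr _ _).1 (hP i j hij)
    refine ⟨ratPoint (Fin.append a b), fun i => ?_⟩
    rw [padZeros_ratPoint, distanceGraph_adj_ratPoint hr]
    simpa [Fin.sum_univ_add] using hab i
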